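/- Let $N\ge 2$ and let $\Omega_1,\Omega\subset\mathbb R^N$ be bounded open sets with $\overline{\Omega_1}\subset\Omega$. Let $\mathcal A$ be the family of all compact sets contained in $\overline{\Omega_1}$. For $K\in\mathcal A$, regard $H^1(\Omega\setminus K)$ as a closed subspace of the real Hilbert space $L^2(\Omega,\mathbb R^{N+1})$ through the isometric immersion $u\mapsto(u,\nabla u)$, where $u$ and its weak gradient $\nabla u$ are extended by zero in $K$. A sequence $(A_n)_{n\in\mathbb N}$ of closed subspaces of a Hilbert space $X$ is said to converge in the sense of Mosco to a closed subspace $A$ if $A=A'=A''$, where $A'$ is the set of all weak limits of sequences $(x_k)_k$ with $x_k\in A_{n_k}$ for all $k$, for some subsequence $(A_{n_k})_k$ of $(A_n)_n$, and $A''$ is the set of all strong limits of sequences $(x_n)_n$ with $x_n\in A_n$ for all $n$. Let $(K_n)_{n\in\mathbb N}$ be a sequence in $\mathcal A$ and let $K,\tilde K\in\mathcal A$. Suppose that, as $n\to\infty$, $H^1(\Omega\setminus\partial K_n)$ converges to $H^1(\Omega\setminus\tilde K)$ in the sense of Mosco, $\partial K_n$ converges to $\tilde K$ in the Hausdorff distance,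 and $K_n$ converges to $K$ in the Hausdorff distance (the empty set being at infinite distance from every nonempty set). Then $H^1(\Omega\setminus K_n)$ converges to $H^1(\Omega\setminus K)$ in the sense of Mosco, as $n\to\infty$. -/

import Mathlib

open MeasureTheory Filter Topology Set
open scoped ENNReal ContDiff

noncomputable section

/-! ### Mosco convergence of closed subspaces -/

namespace Mosco

variable {X : Type*} [NormedAddCommGroup X] [NormedSpace ℝ X]

/-- The set `A'` of all weak limits of sequences `y k ∈ A (n k)`, for some subsequence
`A (n k)` of the sequence of closed subspaces `A n`. -/
def weakUpperLimit (A : ℕ → ClosedSubmodule ℝ X) : Set X :=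
  {x | ∃ n : ℕ → ℕ, StrictMono n ∧ ∃ y : ℕ → X, (∀ k, y k ∈ A (n k)) ∧
    ∀ l : StrongDual ℝ X, Tendsto (fun k => l (y k)) atTop (𝓝 (l x))}

/-- The set `A''` of all strong limits of sequences `y n ∈ A n`. -/
def strongLowerLimit (A : ℕ → ClosedSubmodule ℝ X) : Set X :=
  {x | ∃ y : ℕ → X, (∀ n, y n ∈ A n) ∧ Tendsto y atTop (𝓝 x)}

/-- The closed subspaces `A n` converge to the closed subspace `B` in the sense of Mosco:
`B = A' = A''`. -/
def Converges (A : ℕ → ClosedSubmodule ℝ X) (B : ClosedSubmodule ℝ X) : Prop :=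
  (B : Set X) = weakUpperLimit A ∧ (B : Set X) = strongLowerLimit A

end Mosco

/-! ### The space `H¹(Ω \ K)` as a closed subspace of `L²(Ω, ℝ^{N+1})` -/

namespace NeumannSobolev

/-- `v` is the weak `i`-th partial derivative of `u` in the open set `U`:
`∫_U u ∂ᵢφ = - ∫_U v φ` for all `φ ∈ C_c^∞(U)`. It is used for square integrable `u`, `v` only,
so that both integrals are genuine. -/
def IsWeakPartialDeriv {N : ℕ} (U : Set (EuclideanSpace ℝ (Fin N))) (i : Fin N)
    (u v : EuclideanSpace ℝ (Fin N) → ℝ) : Prop :=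
  ∀ φ : EuclideanSpace ℝ (Fin N) → ℝ,
    ContDiff ℝ ∞ φ → HasCompactSupport φ → tsupport φ ⊆ U →
      ∫ x in U, u x * fderiv ℝ φ x (EuclideanSpace.single i 1) = - ∫ x in U, v x * φ x

/-- `L²(Ω, ℝ^{N+1})`, a Hilbert space. -/
abbrev L2Vec {N : ℕ} (Ω : Set (EuclideanSpace ℝ (Fin N))) : Type :=
  Lp (EuclideanSpace ℝ (Fin (N + 1))) 2 (volume.restrict Ω)

/-- Pairing with a coordinate over a subset is linear and continuous on `L²(Ω, ℝ^{N+1})`. -/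
theorem exists_pairing {N : ℕ} {Ω U : Set (EuclideanSpace ℝ (Fin N))} (hU : U ⊆ Ω)
    (k : Fin (N + 1)) {ψ : EuclideanSpace ℝ (Fin N) → ℝ} (hψ : Continuous ψ)
    (hc : HasCompactSupport ψ) :
    ∃ l : L2Vec Ω →L[ℝ] ℝ, ∀ F : L2Vec Ω, l F = ∫ x in U, F x k * ψ x := by
  have hm : MemLp ψ 2 ((volume.restrict Ω).restrict U) := by
    exact (hψ.memLp_of_hasCompactSupport hc).mono_measure
      (Measure.restrict_le_self.trans Measure.restrict_le_self)
  refine ⟨(innerSL ℝ hm.toLp).comp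
    (((EuclideanSpace.proj k : EuclideanSpace ℝ (Fin (N + 1)) →L[ℝ] ℝ).compLpL 2 _).comp
      (LpToLpRestrictCLM _ _ ℝ (volume.restrict Ω) 2 U)), fun F => ?_⟩
  simp only [ContinuousLinearMap.comp_apply, innerSL_apply_apply, L2.inner_def]
  conv_rhs => rw [← Measure.restrict_restrict_of_subset hU]
  apply integral_congr_ae
  filter_upwards [hm.coeFn_toLp, LpToLpRestrictCLM_coeFn ℝ U F,
    (EuclideanSpace.proj k : EuclideanSpace ℝ (Fin (N + 1)) →L[ℝ] ℝ).coeFn_compLpL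
      (LpToLpRestrictCLM _ _ ℝ (volume.restrict Ω) 2 U F)] with x h1 h2 h3
  rw [h1, h3, h2]
  simp

/-- Restriction to a subset is linear and continuous on `L²(Ω, ℝ^{N+1})`. -/
theorem exists_restriction {N : ℕ} {Ω U : Set (EuclideanSpace ℝ (Fin N))} (hU : U ⊆ Ω) :
    ∃ l : L2Vec Ω →L[ℝ] Lp (EuclideanSpace ℝ (Fin (N + 1))) 2 ((volume.restrict Ω).restrict U),
      ∀ F : L2Vec Ω, l F = 0 ↔ F =ᵐ[volume.restrict U] 0 := by
  refine ⟨LpToLpRestrictCLM _ _ ℝ (volume.restrict Ω) 2 U, fun F => ?_⟩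
  have h := LpToLpRestrictCLM_coeFn ℝ U F
  have e : F =ᵐ[volume.restrict U] 0 ↔ F =ᵐ[(volume.restrict Ω).restrict U] 0 := by
    rw [Measure.restrict_restrict_of_subset hU]
  rw [Lp.eq_zero_iff_ae_eq_zero, e]
  exact ⟨fun h0 => h.symm.trans h0, fun h0 => h.trans h0⟩

/-- The condition of having a given weak partial derivative is closed and linear. -/
theorem exists_pairing_family {N : ℕ} (Ω U : Set (EuclideanSpace ℝ (Fin N))) (hU : U ⊆ Ω)
    (i : Fin N) :
    ∃ T : Set (L2Vec Ω →L[ℝ] ℝ), ∀ F : L2Vec Ω,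
      IsWeakPartialDeriv U i (fun x => F x 0) (fun x => F x i.succ) ↔ ∀ l ∈ T, l F = 0 := by
  have key : ∀ φ : EuclideanSpace ℝ (Fin N) → ℝ, ContDiff ℝ ∞ φ → HasCompactSupport φ →
      ∃ l : L2Vec Ω →L[ℝ] ℝ, ∀ F : L2Vec Ω, l F =
        (∫ x in U, F x 0 * fderiv ℝ φ x (EuclideanSpace.single i 1))
          + ∫ x in U, F x i.succ * φ x := by
    intro φ h1 h2
    obtain ⟨a, ha⟩ := exists_pairing hU 0
      (ψ := fun x => fderiv ℝ φ x (EuclideanSpace.single i 1))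
      ((h1.continuous_fderiv (by simp)).clm_apply continuous_const) (h2.fderiv_apply ℝ _)
    obtain ⟨b, hb⟩ := exists_pairing hU i.succ h1.continuous h2
    exact ⟨a + b, fun F => by rw [_root_.add_apply, ha, hb]⟩
  choose L hL using key
  refine ⟨{l | ∃ φ h1 h2, tsupport φ ⊆ U ∧ l = L φ h1 h2}, fun F => ⟨?_, ?_⟩⟩
  · rintro h l ⟨φ, h1, h2, h3, rfl⟩
    rw [hL, h φ h1 h2 h3, neg_add_cancel]
  · intro h φ h1 h2 h3
    have := h _ ⟨φ, h1, h2, h3, rfl⟩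
    rw [hL] at this
    exact eq_neg_of_add_eq_zero_left this

/-- `H¹(Ω \ K)`, seen inside `L²(Ω, ℝ^{N+1})` through `u ↦ (u, ∇u)`, with `u` and `∇u` extended
by zero in `K`: the vector fields `F = (F₀, F₁, …, F_N)` that vanish a.e. in `K` and such that in
`Ω \ K` the function `F₀` has weak gradient `(F₁, …, F_N)`. -/
def H1 {N : ℕ} (Ω K : Set (EuclideanSpace ℝ (Fin N))) : ClosedSubmodule ℝ (L2Vec Ω) where
  carrier := {F | F =ᵐ[volume.restrict (Ω ∩ K)] 0 ∧
    ∀ i : Fin N, IsWeakPartialDeriv (Ω \ K) i (fun x => F x 0) (fun x => F x i.succ)}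
  add_mem' := by
    rintro F G ⟨hF, hF'⟩ ⟨hG, hG'⟩
    obtain ⟨r, hr⟩ := exists_restriction (inter_subset_left : Ω ∩ K ⊆ Ω)
    refine ⟨(hr _).1 (by rw [map_add, (hr F).2 hF, (hr G).2 hG, add_zero]), fun i => ?_⟩
    obtain ⟨T, hT⟩ := exists_pairing_family Ω (Ω \ K) sdiff_subset i
    exact (hT _).2 fun l hl => by
      rw [map_add, (hT F).1 (hF' i) l hl, (hT G).1 (hG' i) l hl, add_zero]
  zero_mem' := by
    obtain ⟨r, hr⟩ := exists_restriction (inter_subset_left : Ω ∩ K ⊆ Ω)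
    refine ⟨(hr _).1 (map_zero r), fun i => ?_⟩
    obtain ⟨T, hT⟩ := exists_pairing_family Ω (Ω \ K) sdiff_subset i
    exact (hT _).2 fun l _ => map_zero l
  smul_mem' := by
    rintro c F ⟨hF, hF'⟩
    obtain ⟨r, hr⟩ := exists_restriction (inter_subset_left : Ω ∩ K ⊆ Ω)
    refine ⟨(hr _).1 (by rw [map_smul, (hr F).2 hF, smul_zero]), fun i => ?_⟩
    obtain ⟨T, hT⟩ := exists_pairing_family Ω (Ω \ K) sdiff_subset i
    exact (hT _).2 fun l hl => by rw [map_smul, (hT F).1 (hF' i) l hl, smul_zero]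
  isClosed' := by
    obtain ⟨r, hr⟩ := exists_restriction (inter_subset_left : Ω ∩ K ⊆ Ω)
    choose T hT using exists_pairing_family Ω (Ω \ K) sdiff_subset
    simp only [← hr, hT, ofPred_and, ofPred_forall]
    exact (isClosed_eq r.continuous continuous_const).inter
      (isClosed_iInter fun i => isClosed_iInter fun l => isClosed_iInter fun _ =>
        isClosed_eq l.continuous continuous_const)

/-- The class of compact subsets of `closure Ω₁`. -/
def compactsIn {N : ℕ} (Ω₁ : Set (EuclideanSpace ℝ (Fin N))) :
    Set (Set (EuclideanSpace ℝ (Fin N))) :=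
  {K | IsCompact K ∧ K ⊆ closure Ω₁}

/-- Convergence `K n → L` in the Hausdorff distance (the empty set has infinite distance from
every nonempty set). -/
def HausdorffConverges {N : ℕ} (K : ℕ → Set (EuclideanSpace ℝ (Fin N)))
    (L : Set (EuclideanSpace ℝ (Fin N))) : Prop :=
  Tendsto (fun n => Metric.hausdorffEDist (K n) L) atTop (𝓝 0)

end NeumannSobolev

end

/-! Everything rests on the inclusions `frontier K' ⊆ Kt ⊆ K'` and on one fact about balls: near a
point of `K'` off `Kt`, a small ball eventually misses `frontier (K n)` but meets `K n`, so by
connectedness it lies in `K n` (`exists_ball_eventually_subset`).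

Extension by zero embeds `H1 Ω K` in `H1 Ω L` whenever `frontier K ⊆ L ⊆ K`
(`H1_le_of_frontier_subset`). Hence a weak limit of elements of `H1 Ω (K n)` lies in `H1 Ω Kt`; it
also vanishes on `K' \ Kt`, by the fact about balls, so it lies in `H1 Ω K'`. Conversely, an element
`F` of `H1 Ω K'` lies in `H1 Ω Kt`, hence is a strong limit of fields in `H1 Ω (frontier (K n))`.
Truncating these to zero on `K n` puts them in `H1 Ω (K n)` and keeps the limit, since the part of
`F` on `K n` tends to zero in `L²`. -/

theorem IsPreconnected.subset_interior_of_disjoint_frontier {α : Type*} [TopologicalSpace α]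
    {s t : Set α} (hs : IsPreconnected s) (ht : IsClosed t) (hd : Disjoint s (frontier t))
    (hne : (s ∩ t).Nonempty) : s ⊆ interior t := by
  have hmem : ∀ z ∈ s, z ∈ t → z ∈ interior t := fun z hz hzt => by
    by_contra h
    exact disjoint_left.1 hd hz (by rw [ht.frontier_eq]; exact ⟨hzt, h⟩)
  refine hs.subset_left_of_subset_union isOpen_interior ht.isOpen_compl
    (disjoint_compl_right.mono_left interior_subset)
    (fun z hz => ?_) ?_
  · by_cases hzt : z ∈ t
    exacts [Or.inl (hmem z hz hzt), Or.inr hzt]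
  · obtain ⟨z, hz, hzt⟩ := hne
    exact ⟨z, hz, hmem z hz hzt⟩

/-- The truncations of an `L^p` function to sets that eventually avoid almost every point of its
support converge to zero in `L^p`. -/
theorem MeasureTheory.MemLp.tendsto_eLpNorm_indicator_zero {α E : Type*} [MeasurableSpace α]
    [NormedAddCommGroup E] {μ : Measure α} {p : ℝ≥0∞} (hp : p ≠ 0) (hp' : p ≠ ⊤) {f : α → E}
    (hf : MemLp f p μ) {s : ℕ → Set α} (hs : ∀ n, MeasurableSet (s n))
    (h : ∀ᵐ x ∂μ, f x ≠ 0 → ∀ᶠ n in atTop, x ∉ s n) :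
    Tendsto (fun n => eLpNorm ((s n).indicator f) p μ) atTop (𝓝 0) := by
  have hpos := ENNReal.toReal_pos hp hp'
  simp_rw [eLpNorm_eq_lintegral_rpow_enorm_toReal hp hp']
  have key : Tendsto (fun n => ∫⁻ x, ‖(s n).indicator f x‖ₑ ^ p.toReal ∂μ) atTop
      (𝓝 (∫⁻ _, 0 ∂μ)) := by
    refine tendsto_lintegral_of_dominated_convergence' (fun x => ‖f x‖ₑ ^ p.toReal)
      (fun n => ((hf.1.indicator (hs n)).enorm.pow_const _)) (fun n => ?_)
      (lintegral_rpow_enorm_lt_top_of_eLpNorm_lt_top hp hp' hf.2).ne ?_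
    · filter_upwards with x
      refine ENNReal.rpow_le_rpow ?_ hpos.le
      rw [enorm_indicator_eq_indicator_enorm]
      exact indicator_le_self _ _ x
    · filter_upwards [h] with x hx
      by_cases h0 : f x = 0
      · have hz : ∀ n, (s n).indicator f x = 0 := fun n => indicator_apply_eq_zero.2 fun _ => h0
        simp [hz, hpos]
      · refine tendsto_const_nhds.congr' ?_
        filter_upwards [hx h0] with n hn
        simp [hn, hpos]
  rw [lintegral_zero] at key
  simpa [hpos] using key.ennrpow_const (1 / p.toReal)

namespace NeumannSobolev

variable {N : ℕ} {Ω : Set (EuclideanSpace ℝ (Fin N))}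

/-! ### Hausdorff limits of closed sets and of their boundaries -/

theorem HausdorffConverges.eventually_inter_ball_nonempty
    {K : ℕ → Set (EuclideanSpace ℝ (Fin N))} {L : Set (EuclideanSpace ℝ (Fin N))}
    (h : HausdorffConverges K L) {x : EuclideanSpace ℝ (Fin N)} (hx : x ∈ L) {r : ℝ}
    (hr : 0 < r) : ∀ᶠ n in atTop, (Metric.ball x r ∩ K n).Nonempty := by
  have h' := Tendsto.eventually_lt_const (ENNReal.ofReal_pos.2 hr) h
  filter_upwards [h'] with n hn
  rw [Metric.hausdorffEDist_comm] at hn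
  obtain ⟨y, hy, hxy⟩ := Metric.exists_edist_lt_of_hausdorffEDist_lt hx hn
  refine ⟨y, ?_, hy⟩
  rw [edist_comm, edist_dist] at hxy
  exact (ENNReal.ofReal_lt_ofReal_iff hr).1 hxy

theorem HausdorffConverges.exists_eventually_disjoint_ball
    {K : ℕ → Set (EuclideanSpace ℝ (Fin N))} {L : Set (EuclideanSpace ℝ (Fin N))}
    (h : HausdorffConverges K L) (hL : IsClosed L) {x : EuclideanSpace ℝ (Fin N)} (hx : x ∉ L) :
    ∃ r > 0, ∀ᶠ n in atTop, Disjoint (Metric.ball x r) (K n) := by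
  obtain ⟨r, hr, hrL⟩ := Metric.isOpen_iff.1 hL.isOpen_compl x hx
  refine ⟨r / 2, half_pos hr, ?_⟩
  have h' := Tendsto.eventually_lt_const (ENNReal.ofReal_pos.2 (half_pos hr)) h
  filter_upwards [h'] with n hn
  refine disjoint_left.2 fun y hy hyK => ?_
  obtain ⟨z, hz, hyz⟩ := Metric.exists_edist_lt_of_hausdorffEDist_lt hyK hn
  rw [edist_dist] at hyz
  have h1 := (ENNReal.ofReal_lt_ofReal_iff (half_pos hr)).1 hyz
  refine hrL (?_ : z ∈ Metric.ball x r) hz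
  rw [Metric.mem_ball] at hy ⊢
  rw [dist_comm] at h1
  linarith [dist_triangle z y x]

/-- Away from the limit of the boundaries, the limit set and the sets of the sequence
eventually contain a common ball. -/
theorem exists_ball_eventually_subset {K : ℕ → Set (EuclideanSpace ℝ (Fin N))}
    {K' Kt : Set (EuclideanSpace ℝ (Fin N))} (hK : ∀ n, IsClosed (K n)) (hKt : IsClosed Kt)
    (hfr : HausdorffConverges (fun n => frontier (K n)) Kt) (hconv : HausdorffConverges K K')
    {x : EuclideanSpace ℝ (Fin N)} (hx : x ∈ K') (hxt : x ∉ Kt) :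
    ∃ r > 0, ∀ᶠ n in atTop, Metric.ball x r ⊆ K n := by
  obtain ⟨r, hr, h⟩ := hfr.exists_eventually_disjoint_ball hKt hxt
  refine ⟨r, hr, ?_⟩
  filter_upwards [h, hconv.eventually_inter_ball_nonempty hx hr] with n h1 h2
  exact ((convex_ball x r).isPreconnected.subset_interior_of_disjoint_frontier (hK n) h1
    h2).trans interior_subset

/-- Around a point of `K'` off `Kt` some ball is eventually contained in `K n`. A point of that ball
outside `K'` would eventually be outside `K n`, so the ball lies in `K'` and its centre is interior.
-/
theorem frontier_subset_of_hausdorffConverges {K : ℕ → Set (EuclideanSpace ℝ (Fin N))}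
    {K' Kt : Set (EuclideanSpace ℝ (Fin N))} (hK : ∀ n, IsClosed (K n)) (hK' : IsClosed K')
    (hKt : IsClosed Kt)
    (hfr : HausdorffConverges (fun n => frontier (K n)) Kt) (hconv : HausdorffConverges K K') :
    frontier K' ⊆ Kt := by
  intro x hx
  by_contra hxt
  obtain ⟨r, hr, h⟩ := exists_ball_eventually_subset hK hKt hfr hconv (hK'.frontier_subset hx) hxt
  refine hx.2 (mem_interior.2 ⟨_, fun y hy => ?_, Metric.isOpen_ball, Metric.mem_ball_self hr⟩)
  by_contra hyK
  obtain ⟨ρ, hρ, h'⟩ := hconv.exists_eventually_disjoint_ball hK' hyK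
  obtain ⟨n, h1, h2⟩ := (h.and h').exists
  exact disjoint_left.1 h2 (Metric.mem_ball_self hρ) (h1 hy)

theorem subset_of_hausdorffConverges_frontier {K : ℕ → Set (EuclideanSpace ℝ (Fin N))}
    {K' Kt : Set (EuclideanSpace ℝ (Fin N))} (hK : ∀ n, IsClosed (K n)) (hK' : IsClosed K')
    (hfr : HausdorffConverges (fun n => frontier (K n)) Kt) (hconv : HausdorffConverges K K') :
    Kt ⊆ K' := by
  intro x hx
  by_contra hxK
  obtain ⟨r, hr, h⟩ := hconv.exists_eventually_disjoint_ball hK' hxK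
  obtain ⟨n, h1, y, hy, hyK⟩ := (h.and (hfr.eventually_inter_ball_nonempty hx hr)).exists
  exact disjoint_left.1 h1 hy ((hK n).frontier_subset hyK)

/-! ### Zero extension and truncation of Sobolev fields -/

theorem IsWeakPartialDeriv.mono {U V : Set (EuclideanSpace ℝ (Fin N))} {i : Fin N}
    {u v : EuclideanSpace ℝ (Fin N) → ℝ} (h : IsWeakPartialDeriv V i u v)
    (hV : MeasurableSet V) (hUV : U ⊆ V) : IsWeakPartialDeriv U i u v := by
  intro φ h1 h2 h3
  have hout : ∀ x ∉ U, φ x = 0 ∧ fderiv ℝ φ x = 0 := fun x hx =>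
    ⟨image_eq_zero_of_notMem_tsupport fun hxφ => hx (h3 hxφ),
      fderiv_of_notMem_tsupport (𝕜 := ℝ) fun hxφ => hx (h3 hxφ)⟩
  have := h φ h1 h2 (h3.trans hUV)
  rwa [setIntegral_eq_of_subset_of_forall_sdiff_eq_zero hV hUV,
    setIntegral_eq_of_subset_of_forall_sdiff_eq_zero hV hUV] at this
  · intro x hx
    rw [(hout x hx.2).1, mul_zero]
  · intro x hx
    rw [(hout x hx.2).2, _root_.zero_apply, mul_zero]

theorem IsWeakPartialDeriv.congr_ae {U : Set (EuclideanSpace ℝ (Fin N))} {i : Fin N}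
    {u v u' v' : EuclideanSpace ℝ (Fin N) → ℝ} (h : IsWeakPartialDeriv U i u v)
    (hu : u =ᵐ[volume.restrict U] u') (hv : v =ᵐ[volume.restrict U] v') :
    IsWeakPartialDeriv U i u' v' := by
  intro φ h1 h2 h3
  exact (integral_congr_ae (hu.symm.mul (ae_eq_refl _))).trans
    ((h φ h1 h2 h3).trans (congrArg _ (integral_congr_ae (hv.mul (ae_eq_refl _)))))

/-- Cutting off a test function at the part of the boundary of `K` that it avoids. -/
theorem contDiff_indicator_compl {K : Set (EuclideanSpace ℝ (Fin N))}
    {φ : EuclideanSpace ℝ (Fin N) → ℝ} (hφ : ContDiff ℝ ∞ φ)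
    (hd : Disjoint (tsupport φ) (frontier K)) : ContDiff ℝ ∞ (Kᶜ.indicator φ) := by
  rw [contDiff_iff_contDiffAt]
  intro x
  by_cases hx : x ∈ tsupport φ
  · have hxf := disjoint_left.1 hd hx
    by_cases hxK : x ∈ interior K
    · refine (contDiffAt_const (c := (0 : ℝ))).congr_of_eventuallyEq ?_
      filter_upwards [mem_interior_iff_mem_nhds.1 hxK] with y hy
      simp [hy]
    · have hxc : x ∉ closure K := fun hc => hxf ⟨hc, hxK⟩
      refine hφ.contDiffAt.congr_of_eventuallyEq ?_
      filter_upwards [isClosed_closure.isOpen_compl.mem_nhds hxc] with y hy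
      exact indicator_of_mem (mem_compl fun hyK => hy (subset_closure hyK)) φ
  · refine (contDiffAt_const (c := (0 : ℝ))).congr_of_eventuallyEq ?_
    filter_upwards [(isClosed_tsupport φ).isOpen_compl.mem_nhds hx] with y hy
    simp [indicator, image_eq_zero_of_notMem_tsupport hy]

/-- If `F` lies in `H¹(Ω \ K)` and `L ⊆ K` contains the boundary of `K`, then `F` lies in
`H¹(Ω \ L)`. -/
theorem H1_le_of_frontier_subset {K L : Set (EuclideanSpace ℝ (Fin N))} (hΩ : MeasurableSet Ω)
    (hK : IsClosed K) (hL : IsClosed L) (hLK : L ⊆ K) (hfr : frontier K ⊆ L) :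
    H1 Ω K ≤ H1 Ω L := by
  rintro F ⟨hF, hF'⟩
  refine ⟨ae_restrict_of_ae_restrict_of_subset (inter_subset_inter_right Ω hLK) hF,
    fun i φ h1 h2 h3 => ?_⟩
  have hdL : Disjoint (tsupport φ) L := disjoint_left.2 fun x hx => (h3 hx).2
  -- The support of `φ` avoids `L`, hence `frontier K`, so `φ` set to zero on `K` is still smooth
  -- and is a test function for `Ω \ K`. As `F` vanishes on `K`, neither integral changes.
  have hψ := contDiff_indicator_compl h1 (hdL.mono_right hfr)
  have hψs : tsupport (Kᶜ.indicator φ) ⊆ tsupport φ :=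
    closure_mono (by rw [support_indicator]; exact inter_subset_right)
  have hψU : tsupport (Kᶜ.indicator φ) ⊆ Ω \ K := fun x hx => by
    have hxφ := hψs hx
    refine ⟨(h3 hxφ).1, fun hxK => ?_⟩
    have hxi : x ∈ interior K := by
      by_contra hxi
      exact disjoint_left.1 hdL hxφ (hfr ⟨subset_closure hxK, hxi⟩)
    refine notMem_tsupport_iff_eventuallyEq.2 ?_ hx
    filter_upwards [mem_interior_iff_mem_nhds.1 hxi] with y hy
    simp [hy]
  have key := hF' i _ hψ (h2.mono' (subset_closure.trans hψs)) hψU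
  have hd : ∀ x ∈ Ω \ K, fderiv ℝ (Kᶜ.indicator φ) x = fderiv ℝ φ x := fun x hx => by
    refine EventuallyEq.fderiv_eq ?_
    filter_upwards [hK.isOpen_compl.mem_nhds hx.2] with y hy
    exact indicator_of_mem hy φ
  have hmK : MeasurableSet (Ω \ K) := hΩ.diff hK.measurableSet
  have hsub : Ω \ K ⊆ Ω \ L := sdiff_subset_sdiff_right hLK
  have h0 : ∀ᵐ x, x ∈ (Ω \ L) \ (Ω \ K) → F x = 0 := by
    filter_upwards [(ae_restrict_iff' (hΩ.inter hK.measurableSet)).1 hF] with x hx hxL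
    exact hx ⟨hxL.1.1, by_contra fun h => hxL.2 ⟨hxL.1.1, h⟩⟩
  have hmL : NullMeasurableSet (Ω \ L) := (hΩ.diff hL.measurableSet).nullMeasurableSet
  rw [setIntegral_eq_of_subset_of_ae_sdiff_eq_zero hmL hsub,
    setIntegral_eq_of_subset_of_ae_sdiff_eq_zero hmL hsub]
  · refine Eq.trans (setIntegral_congr_fun hmK fun x hx => ?_)
      (key.trans (congrArg _ (setIntegral_congr_fun hmK fun x hx => ?_)))
    · simp only [hd x hx]
    · simp only [indicator_of_mem (mem_compl hx.2)]
  · filter_upwards [h0] with x hx hxL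
    simp [hx hxL]
  · filter_upwards [h0] with x hx hxL
    simp [hx hxL]

/-- The jump created across the boundary of `K` is harmless: test functions for `Ω \ K` see only the
region where the truncation equals `F`. -/
theorem toLp_indicator_compl_mem_H1 {K L : Set (EuclideanSpace ℝ (Fin N))}
    (hΩ : MeasurableSet Ω) (hK : MeasurableSet K) (hL : MeasurableSet L) (hLK : L ⊆ K)
    {F : L2Vec Ω} (hF : F ∈ H1 Ω L) :
    ((Lp.memLp F).indicator hK.compl).toLp _ ∈ H1 Ω K := by
  have hG := ((Lp.memLp F).indicator hK.compl).coeFn_toLp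
  constructor
  · filter_upwards [ae_restrict_of_ae_restrict_of_subset inter_subset_left hG,
      ae_restrict_mem (hΩ.inter hK)] with x hx hxK
    rw [hx, indicator_of_notMem (notMem_compl_iff.2 hxK.2)]
    rfl
  · intro i
    have hGU : ((Lp.memLp F).indicator hK.compl).toLp _ =ᵐ[volume.restrict (Ω \ K)] F := by
      filter_upwards [ae_restrict_of_ae_restrict_of_subset sdiff_subset hG,
        ae_restrict_mem (hΩ.diff hK)] with x hx hxK
      rw [hx, indicator_of_mem hxK.2]
    refine ((hF.2 i).mono (hΩ.diff hL) (sdiff_subset_sdiff_right hLK)).congr_ae ?_ ?_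
    · filter_upwards [hGU] with x hx
      rw [hx]
    · filter_upwards [hGU] with x hx
      rw [hx]

/-- Vanishing almost everywhere on a subset is preserved by weak limits. -/
theorem ae_eq_zero_of_weak_limit {U : Set (EuclideanSpace ℝ (Fin N))} (hU : U ⊆ Ω)
    {y : ℕ → L2Vec Ω} {F : L2Vec Ω}
    (hy : ∀ l : StrongDual ℝ (L2Vec Ω), Tendsto (fun k => l (y k)) atTop (𝓝 (l F)))
    (h0 : ∀ᶠ k in atTop, y k =ᵐ[volume.restrict U] 0) : F =ᵐ[volume.restrict U] 0 := by
  obtain ⟨r, hr⟩ := exists_restriction hU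
  refine (hr F).1 (SeparatingDual.eq_zero_of_forall_dual_eq_zero (R := ℝ) fun l => ?_)
  refine tendsto_nhds_unique (hy (l.comp r)) (tendsto_const_nhds.congr' ?_)
  filter_upwards [h0] with k hk
  rw [ContinuousLinearMap.comp_apply, (hr _).2 hk, map_zero]

/-! ### The two inclusions of Mosco convergence -/

theorem weakUpperLimit_H1_subset {K : ℕ → Set (EuclideanSpace ℝ (Fin N))}
    {K' Kt : Set (EuclideanSpace ℝ (Fin N))} (hΩ : IsOpen Ω) (hK : ∀ n, IsClosed (K n))
    (hK' : IsClosed K') (hKt : IsClosed Kt) (hK'Ω : K' ⊆ Ω)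
    (hMosco : Mosco.weakUpperLimit (fun n => H1 Ω (frontier (K n))) ⊆ (H1 Ω Kt : Set (L2Vec Ω)))
    (hfr : HausdorffConverges (fun n => frontier (K n)) Kt) (hconv : HausdorffConverges K K') :
    Mosco.weakUpperLimit (fun n => H1 Ω (K n)) ⊆ (H1 Ω K' : Set (L2Vec Ω)) := by
  rintro F ⟨n, hn, y, hy, hlim⟩
  have hFt : F ∈ H1 Ω Kt := hMosco ⟨n, hn, y, fun k =>
    H1_le_of_frontier_subset hΩ.measurableSet (hK _) isClosed_frontier (hK _).frontier_subset
      Subset.rfl (hy k), hlim⟩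
  have hsub := subset_of_hausdorffConverges_frontier hK hK' hfr hconv
  refine ⟨?_, fun i => (hFt.2 i).mono (hΩ.measurableSet.diff hKt.measurableSet)
    (sdiff_subset_sdiff_right hsub)⟩
  rw [inter_eq_right.2 hK'Ω]
  have ht := hFt.1
  rw [inter_eq_right.2 (hsub.trans hK'Ω)] at ht
  have hdiff : F =ᵐ[volume.restrict (K' \ Kt)] 0 := by
    rw [EventuallyEq, ae_restrict_iff' (hK'.measurableSet.diff hKt.measurableSet), ae_iff]
    -- The ball on which the `y k` eventually vanish depends on the point, so nullity is checked
    -- locally.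
    refine measure_null_of_locally_null _ fun x hx => ?_
    simp only [mem_ofPred_eq, Classical.not_imp] at hx
    obtain ⟨r, hr, h⟩ := exists_ball_eventually_subset hK hKt hfr hconv hx.1.1 hx.1.2
    have hb : F =ᵐ[volume.restrict (Ω ∩ Metric.ball x r)] 0 := by
      refine ae_eq_zero_of_weak_limit inter_subset_left hlim ?_
      filter_upwards [hn.tendsto_atTop.eventually h] with k hk
      exact ae_restrict_of_ae_restrict_of_subset (inter_subset_inter_right Ω hk) (hy k).1
    rw [EventuallyEq, ae_restrict_iff' (hΩ.inter Metric.isOpen_ball).measurableSet, ae_iff] at hb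
    refine ⟨_, inter_mem_nhdsWithin _ (Metric.ball_mem_nhds x hr), measure_mono_null ?_ hb⟩
    rintro z ⟨hz, hzb⟩
    simp only [mem_ofPred_eq, Classical.not_imp] at hz ⊢
    exact ⟨⟨hK'Ω hz.1.1, hzb⟩, hz.2⟩
  rw [← union_sdiff_cancel hsub]
  exact (ae_restrict_union_iff _ _ _).2 ⟨ht, hdiff⟩

theorem H1_subset_strongLowerLimit {K : ℕ → Set (EuclideanSpace ℝ (Fin N))}
    {K' Kt : Set (EuclideanSpace ℝ (Fin N))} (hΩ : IsOpen Ω) (hK : ∀ n, IsClosed (K n))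
    (hK' : IsClosed K') (hKt : IsClosed Kt)
    (hMosco : (H1 Ω Kt : Set (L2Vec Ω)) ⊆
      Mosco.strongLowerLimit (fun n => H1 Ω (frontier (K n))))
    (hfr : HausdorffConverges (fun n => frontier (K n)) Kt) (hconv : HausdorffConverges K K') :
    (H1 Ω K' : Set (L2Vec Ω)) ⊆ Mosco.strongLowerLimit (fun n => H1 Ω (K n)) := by
  intro F hF
  obtain ⟨y, hy, hlim⟩ := hMosco (H1_le_of_frontier_subset hΩ.measurableSet hK' hKt
    (subset_of_hausdorffConverges_frontier hK hK' hfr hconv)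
    (frontier_subset_of_hausdorffConverges hK hK' hKt hfr hconv) hF)
  refine ⟨fun n => ((Lp.memLp (y n)).indicator (hK n).measurableSet.compl).toLp _, fun n =>
    toLp_indicator_compl_mem_H1 hΩ.measurableSet (hK n).measurableSet
      isClosed_frontier.measurableSet (hK n).frontier_subset (hy n), ?_⟩
  rw [Lp.tendsto_Lp_iff_tendsto_eLpNorm'] at hlim ⊢
  -- Almost every point where `F` is nonzero lies outside `K'`, hence eventually outside `K n`.
  have hcut : Tendsto (fun n => eLpNorm ((K n).indicator F) 2 (volume.restrict Ω)) atTop (𝓝 0) := by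
    refine (Lp.memLp F).tendsto_eLpNorm_indicator_zero two_ne_zero ENNReal.ofNat_ne_top
      (fun n => (hK n).measurableSet) ?_
    have h0 := hF.1
    rw [← Measure.restrict_restrict_of_subset (inter_subset_left : Ω ∩ K' ⊆ Ω), EventuallyEq,
      ae_restrict_iff' (hΩ.measurableSet.inter hK'.measurableSet)] at h0
    filter_upwards [h0, ae_restrict_mem hΩ.measurableSet] with x hx hxΩ hne
    obtain ⟨r, hr, h⟩ := hconv.exists_eventually_disjoint_ball hK' fun hxK => hne (hx ⟨hxΩ, hxK⟩)
    exact h.mono fun n hn => disjoint_left.1 hn (Metric.mem_ball_self hr)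
  refine tendsto_of_tendsto_of_tendsto_of_le_of_le tendsto_const_nhds
    (by simpa using hlim.add hcut) (fun _ => zero_le) fun n => ?_
  have hm := ((Lp.memLp (y n)).sub (Lp.memLp F)).1
  -- The error splits into that of `y n` off `K n`, bounded by the full error, and the part of `F`
  -- on `K n`, controlled by `hcut`.
  have e : ⇑(((Lp.memLp (y n)).indicator (hK n).measurableSet.compl).toLp _) - ⇑F
      =ᵐ[volume.restrict Ω] (K n)ᶜ.indicator (⇑(y n) - ⇑F) - (K n).indicator F := by
    filter_upwards [((Lp.memLp (y n)).indicator (hK n).measurableSet.compl).coeFn_toLp] with x hx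
    rw [Pi.sub_apply, hx, Pi.sub_apply]
    by_cases hxK : x ∈ K n <;> simp [hxK]
  rw [eLpNorm_congr_ae e]
  exact (eLpNorm_sub_le (hm.indicator (hK n).measurableSet.compl)
    ((Lp.memLp F).1.indicator (hK n).measurableSet) one_le_two).trans
    (by gcongr; exact eLpNorm_indicator_le _)

end NeumannSobolev

theorem Mosco.strongLowerLimit_subset_weakUpperLimit {X : Type*} [NormedAddCommGroup X]
    [NormedSpace ℝ X] (A : ℕ → ClosedSubmodule ℝ X) :
    Mosco.strongLowerLimit A ⊆ Mosco.weakUpperLimit A := by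
  rintro x ⟨y, hy, hlim⟩
  exact ⟨id, strictMono_id, y, hy, fun l => (l.continuous.tendsto x).comp hlim⟩

theorem mainTheorem7 {N : ℕ} (hN : 2 ≤ N) (Ω Ω₁ : Set (EuclideanSpace ℝ (Fin N)))
    (hΩ : IsOpen Ω) (hΩb : Bornology.IsBounded Ω)
    (hΩ₁ : IsOpen Ω₁) (hΩ₁Ω : closure Ω₁ ⊆ Ω)
    (K : ℕ → Set (EuclideanSpace ℝ (Fin N))) (K' Kt : Set (EuclideanSpace ℝ (Fin N)))
    (hK : ∀ n, K n ∈ NeumannSobolev.compactsIn Ω₁)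
    (hK' : K' ∈ NeumannSobolev.compactsIn Ω₁) (hKt : Kt ∈ NeumannSobolev.compactsIn Ω₁)
    (hMosco : Mosco.Converges (fun n => NeumannSobolev.H1 Ω (frontier (K n)))
      (NeumannSobolev.H1 Ω Kt))
    (hfr : NeumannSobolev.HausdorffConverges (fun n => frontier (K n)) Kt)
    (hconv : NeumannSobolev.HausdorffConverges K K') :
    Mosco.Converges (fun n => NeumannSobolev.H1 Ω (K n)) (NeumannSobolev.H1 Ω K') := by
  have hKc := fun n => (hK n).1.isClosed
  have h1 := NeumannSobolev.weakUpperLimit_H1_subset hΩ hKc hK'.1.isClosed hKt.1.isClosed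
    (hK'.2.trans hΩ₁Ω) hMosco.1.ge hfr hconv
  have h2 := NeumannSobolev.H1_subset_strongLowerLimit hΩ hKc hK'.1.isClosed hKt.1.isClosed
    hMosco.2.le hfr hconv
  have h3 := Mosco.strongLowerLimit_subset_weakUpperLimit fun n => NeumannSobolev.H1 Ω (K n)
  -- The cycle `H1 Ω K' ⊆ A'' ⊆ A' ⊆ H1 Ω K'` forces equality throughout.
  exact ⟨(h2.trans h3).antisymm h1, h2.antisymm (h3.trans h1)⟩
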